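/- **Proposition 3.13.** Let $\mathbb{C}\langle\mathbf{X}\rangle$ be the algebra of noncommutative polynomials over $\mathbb{C}$ in the variables $\mathbf{X}_1,\mathbf{X}_2,\dots$, with the (conjugate-linear, order-reversing) involution for which every $\mathbf{X}_\ell$ is self-adjoint. For $n\ge 1$ let $\mathrm{Mat}_n(\mathbb{C}\langle\mathbf{X}\rangle)$ carry the involution $A^*(i,j)=A(j,i)^*$. Let $\mathcal{H}$ be the Hilbert space with orthonormal basis $\{v(i_1\cdots i_k)\}$ indexed by all finite sequences of positive integers, including the empty one; put $1_{\mathcal H}=v(\emptyset)$ and $\phi(A)=(1_{\mathcal H},A1_{\mathcal H})$ for $A\in B(\mathcal{H})$. Let $\Sigma_\ell\in B(\mathcal H)$ be the isometry $\Sigma_\ell v(i_1\cdots i_k)=v(\ell\, i_1\cdots i_k)$, and put $$\Xi_\ell=\mathrm{i}^{\ell}\,\Sigma_\ell+\mathrm{i}^{-\ell}\,\Sigma_\ell^*\qquad(\ell=1,2,\dots),\qquad \Xi=\{\Xi_\ell\}_{\ell=1}^\infty .$$ For $f\in\mathrm{Mat}_n(\mathbb{C}\langle\mathbf{X}\rangle)$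 let $f(\Xi)\in\mathrm{Mat}_n(B(\mathcal H))$ be obtained by evaluating every entry at $\mathbf{X}=\Xi$. Equip the $C^*$-algebra $\mathrm{Mat}_n(B(\mathcal H))$ with the state $\phi_n(A)=\frac1n\sum_{i=1}^n\phi(A(i,i))$. If $f$ is self-adjoint, let $\mu_f$ be the law of $f(\Xi)$, i.e. the unique Borel probability measure on $\mathbb{R}$ carried by the spectrum $\mathrm{Spec}(f(\Xi))\subset\mathbb{R}$ with $\phi_n(g(f(\Xi)))=\int g\,d\mu_f$ for every continuous $g:\mathrm{Spec}(f(\Xi))\to\mathbb{C}$, where $g(f(\Xi))$ is defined by the continuous functional calculus. Then for every $n\ge1$ and every self-adjoint $f\in\mathrm{Mat}_n(\mathbb{C}\langle\mathbf{X}\rangle)$, $$\mathrm{supp}\,\mu_f=\mathrm{Spec}(f(\Xi)).$$ -/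

import Mathlib

noncomputable section

open scoped ComplexOrder ComplexConjugate InnerProductSpace

/-! ### The noncommutative polynomial `*`-algebra -/

/-- The noncommutative polynomial algebra `ℂ⟨X⟩` in variables `X_1, X_2, …`: its elements are the
finite complex linear combinations of words in the positive integers. -/
abbrev NCPoly : Type := MonoidAlgebra ℂ (FreeMonoid ℕ+)

namespace NCPoly

/-- The variable `X_ℓ`. -/
def X (l : ℕ+) : NCPoly := MonoidAlgebra.single (FreeMonoid.of l) 1

/-- The involution of `ℂ⟨X⟩`: conjugate the coefficients and reverse the words. -/
instance instStar : Star NCPoly where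
  star p := MonoidAlgebra.ofCoeff
    ((p.coeff.mapRange conj (map_zero _)).mapDomain (star : FreeMonoid ℕ+ → FreeMonoid ℕ+))

theorem star_single (w : FreeMonoid ℕ+) (c : ℂ) :
    star (MonoidAlgebra.single w c : NCPoly) = MonoidAlgebra.single (star w) (conj c) := by
  show MonoidAlgebra.ofCoeff _ = _
  rw [MonoidAlgebra.coeff_single, Finsupp.mapRange_single, Finsupp.mapDomain_single,
    MonoidAlgebra.ofCoeff_single]

theorem star_zero' : star (0 : NCPoly) = 0 := by
  show MonoidAlgebra.ofCoeff _ = _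
  rw [MonoidAlgebra.coeff_zero, Finsupp.mapRange_zero, Finsupp.mapDomain_zero,
    MonoidAlgebra.ofCoeff_zero]

theorem star_add' (p q : NCPoly) : star (p + q) = star p + star q := by
  show MonoidAlgebra.ofCoeff _ = MonoidAlgebra.ofCoeff _ + MonoidAlgebra.ofCoeff _
  rw [MonoidAlgebra.coeff_add, ← MonoidAlgebra.ofCoeff_add, Finsupp.mapRange_add (by simp),
    Finsupp.mapDomain_add]

instance instStarRing : StarRing NCPoly where
  star_involutive p := by
    induction p using MonoidAlgebra.induction_linear with
    | zero => rw [star_zero', star_zero']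
    | add p q hp hq => rw [star_add', star_add', hp, hq]
    | single w c => simp [star_single]
  star_add := star_add'
  star_mul p q := by
    induction p using MonoidAlgebra.induction_linear with
    | zero => simp [star_zero']
    | add p p' hp hp' => rw [add_mul, star_add', star_add', hp, hp', mul_add]
    | single w c =>
      induction q using MonoidAlgebra.induction_linear with
      | zero => simp [star_zero']
      | add q q' hq hq' => rw [mul_add, star_add', star_add', hq, hq', add_mul]
      | single w' c' => simp [star_single, MonoidAlgebra.single_mul_single, mul_comm]

/-- All the variables are self-adjoint. -/
theorem star_X (l : ℕ+) : star (X l) = X l := by simp [X, star_single]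

/-- Scalars are conjugated. -/
theorem star_smul' (c : ℂ) (p : NCPoly) : star (c • p) = conj c • star p := by
  induction p using MonoidAlgebra.induction_linear with
  | zero => simp
  | add p q hp hq => simp [hp, hq]
  | single w d => simp [star_single, MonoidAlgebra.smul_single]

/-- Evaluation of noncommutative polynomials at a sequence in an algebra. -/
def eval {A : Type*} [Ring A] [Algebra ℂ A] (a : ℕ+ → A) : NCPoly →ₐ[ℂ] A :=
  MonoidAlgebra.lift ℂ A (FreeMonoid ℕ+) (FreeMonoid.lift a)

theorem eval_X {A : Type*} [Ring A] [Algebra ℂ A] (a : ℕ+ → A) (l : ℕ+) :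
    eval a (X l) = a l := by simp [eval, X]

theorem eval_star {A : Type*} [Ring A] [StarRing A] [Algebra ℂ A] [StarModule ℂ A] (a : ℕ+ → A)
    (ha : ∀ l, IsSelfAdjoint (a l)) (p : NCPoly) : eval a (star p) = star (eval a p) := by
  have hw : ∀ w : FreeMonoid ℕ+, FreeMonoid.lift a (star w) = star (FreeMonoid.lift a w) := by
    intro w
    induction w using FreeMonoid.inductionOn' with
    | one => simp
    | of_mul l w ih => simp [ih, (ha l).star_eq]
  induction p using MonoidAlgebra.induction_linear with
  | zero => simp
  | add p q hp hq => simp [hp, hq]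
  | single w d => simp [star_single, eval, hw, star_smul]

/-- Entrywise evaluation `f ↦ f(a)` from `Mat_n(ℂ⟨X⟩)` to `Mat_n(A)`. -/
def evalMatrix {n : ℕ} {A : Type*} [Ring A] [Algebra ℂ A] (a : ℕ+ → A)
    (f : Matrix (Fin n) (Fin n) NCPoly) : CStarMatrix (Fin n) (Fin n) A :=
  CStarMatrix.ofMatrix (f.map (eval a))

theorem isSelfAdjoint_evalMatrix {n : ℕ} {A : Type*} [Ring A] [StarRing A] [Algebra ℂ A]
    [StarModule ℂ A] (a : ℕ+ → A) (ha : ∀ l, IsSelfAdjoint (a l))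
    {f : Matrix (Fin n) (Fin n) NCPoly} (hf : IsSelfAdjoint f) :
    IsSelfAdjoint (evalMatrix a f) := by
  have h : ∀ i j, star (f j i) = f i j := fun i j => congrFun (congrFun hf i) j
  ext i j
  show star (eval a (f j i)) = eval a (f i j)
  rw [← eval_star a ha, h]

end NCPoly

/-! ### States and laws -/

/-- A state on a unital C⋆-algebra: a positive linear functional of value `1` at the unit. -/
structure CStarState (A : Type*) [CStarAlgebra A] where
  toFun : A →ₗ[ℂ] ℂ
  nonneg : ∀ a : A, 0 ≤ toFun (star a * a)
  map_one : toFun 1 = 1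

instance (A : Type*) [CStarAlgebra A] : CoeFun (CStarState A) (fun _ => A → ℂ) :=
  ⟨fun φ => φ.toFun⟩

/-- `μ` is the law of the self-adjoint element `a` in the C⋆-probability space `(A, φ)`: a Borel
probability measure on the real line, carried by `Spec(a)`, with `φ(g(a)) = ∫ g dμ` for every
continuous complex-valued `g` on `Spec(a)`, where `g(a)` is the continuous functional calculus. -/
structure IsLaw {A : Type*} [CStarAlgebra A] (φ : CStarState A) (a : A)
    (μ : MeasureTheory.Measure ℝ) : Prop where
  isProbabilityMeasure : MeasureTheory.IsProbabilityMeasure μ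
  carried : μ {x : ℝ | (x : ℂ) ∉ spectrum ℂ a} = 0
  integral_eq : ∀ g : ℂ → ℂ, ContinuousOn g (spectrum ℂ a) →
    φ (cfc g a) = ∫ x : ℝ, g x ∂μ

section Law

open MeasureTheory

variable {A : Type*} [CStarAlgebra A] (φ : CStarState A) {a : A}

theorem IsLaw.unique {μ ν : Measure ℝ} (hμ : IsLaw φ a μ)
    (hν : IsLaw φ a ν) : μ = ν := by
  have := hμ.isProbabilityMeasure
  have := hν.isProbabilityMeasure
  refine ext_of_forall_integral_eq_of_IsFiniteMeasure fun g => ?_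
  have hc : ContinuousOn (fun z : ℂ => ((g z.re : ℝ) : ℂ)) (spectrum ℂ a) := by fun_prop
  have h := (hμ.integral_eq _ hc).symm.trans (hν.integral_eq _ hc)
  simp only [Complex.ofReal_re] at h
  have e : ∀ ρ : Measure ℝ, ∫ x, ((g x : ℝ) : ℂ) ∂ρ = ((∫ x, g x ∂ρ : ℝ) : ℂ) :=
    fun ρ => integral_ofReal
  rw [e, e] at h
  exact_mod_cast h

theorem exists_isLaw (ha : IsSelfAdjoint a) : ∃ μ : Measure ℝ, IsLaw φ a μ := by
  have hn : IsStarNormal a := ha.isStarNormal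
  let X := spectrum ℂ a
  have hX : CompactSpace X := isCompact_iff_compactSpace.mp (spectrum.isCompact a)
  have hre : ∀ z : X, (((z : ℂ).re : ℝ) : ℂ) = z := fun z => (ha.mem_spectrum_eq_re z.2).symm
  let C : C(X, ℝ) → C(X, ℂ) := fun g => ⟨fun x => (g x : ℂ), by fun_prop⟩
  let ψ : C(X, ℂ) →ₗ[ℂ] ℂ := φ.toFun ∘ₗ (cfcHom (R := ℂ) hn).toAlgHom.toLinearMap
  have hψ : ∀ g, ψ g = φ (cfcHom hn g) := fun _ => rfl
  have hpos : ∀ g : C(X, ℝ), 0 ≤ g → 0 ≤ ψ (C g) := by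
    intro g hg
    let s : C(X, ℝ) := ⟨fun x => Real.sqrt (g x), by fun_prop⟩
    have hs : C g = star (C s) * C s := by
      ext x
      have : Real.sqrt (g x) * Real.sqrt (g x) = g x := Real.mul_self_sqrt (hg x)
      simp [C, s, ← Complex.ofReal_mul, this]
    rw [hψ, hs, map_mul, map_star]
    exact φ.nonneg _
  have hadd : ∀ g h, C (g + h) = C g + C h := fun g h => by ext x; simp [C]
  have hsmul : ∀ (r : ℝ) g, C (r • g) = (r : ℂ) • C g := fun g h => by ext x; simp [C]
  have him : ∀ g : C(X, ℝ), ((ψ (C g)).re : ℂ) = ψ (C g) := by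
    intro g
    have h1 := hpos (g ⊔ 0) le_sup_right
    have h2 := hpos ((-g) ⊔ 0) le_sup_right
    have hg : C g = C (g ⊔ 0) - C ((-g) ⊔ 0) := by
      ext x
      have : g x = max (g x) 0 - max (-g x) 0 := by
        rcases le_total 0 (g x) with h | h <;> simp [h]
      simp [C, ← Complex.ofReal_sub, ← this]
    rw [Complex.nonneg_iff] at h1 h2
    apply Complex.ext
    · simp
    · simp [hg, ← h1.2, ← h2.2]
  let Λ₀ : CompactlySupportedContinuousMap X ℝ →ₗ[ℝ] ℝ :=
    { toFun := fun g => (ψ (C g.toContinuousMap)).re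
      map_add' := fun g h => by
        have : (g + h).toContinuousMap = g.toContinuousMap + h.toContinuousMap := rfl
        rw [this, hadd, map_add, Complex.add_re]
      map_smul' := fun r g => by
        have : (r • g).toContinuousMap = r • g.toContinuousMap := rfl
        rw [this, hsmul, map_smul]
        simp }
  let Λ : CompactlySupportedContinuousMap X ℝ →ₚ[ℝ] ℝ :=
    PositiveLinearMap.mk₀ Λ₀ fun g hg => (Complex.nonneg_iff.mp (hpos _ hg)).1
  let ν := RealRMK.rieszMeasure Λ
  have hfin : IsFiniteMeasure ν := by infer_instance
  have hν : ∀ g : C(X, ℝ), ψ (C g) = ((∫ x, g x ∂ν : ℝ) : ℂ) := by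
    intro g
    let g' : CompactlySupportedContinuousMap X ℝ :=
      ⟨g, HasCompactSupport.of_compactSpace _⟩
    have h := RealRMK.integral_rieszMeasure Λ g'
    have h2 : Λ g' = (ψ (C g)).re := rfl
    rw [← him, ← h2, ← h]
    rfl
  have hνc : ∀ g : C(X, ℂ), ψ g = ∫ x, g x ∂ν := by
    intro g
    let u : C(X, ℝ) := ⟨fun x => (g x).re, by fun_prop⟩
    let v : C(X, ℝ) := ⟨fun x => (g x).im, by fun_prop⟩
    have hg : g = C u + Complex.I • C v := by
      ext x
      simp only [C, u, v, ContinuousMap.add_apply, ContinuousMap.smul_apply,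
        ContinuousMap.coe_mk, smul_eq_mul]
      rw [mul_comm, Complex.re_add_im]
    have hi : Integrable g ν := g.continuous.integrable_of_hasCompactSupport
      (HasCompactSupport.of_compactSpace _)
    conv_lhs => rw [hg]
    rw [map_add, map_smul, hν, hν, ← integral_re_add_im hi]
    simp [u, v, mul_comm]
  have hm : Measurable (fun z : X => (z : ℂ).re) := by fun_prop
  have hone : ψ 1 = 1 := by rw [hψ, map_one]; exact φ.map_one
  refine ⟨ν.map fun z : X => (z : ℂ).re, ?_, ?_, ?_⟩
  · have h1 : ν.real Set.univ = 1 := by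
      have h := hνc 1
      rw [hone] at h
      simp at h
      exact_mod_cast h.symm
    constructor
    rw [Measure.map_apply hm MeasurableSet.univ, Set.preimage_univ]
    rw [measureReal_def] at h1
    exact (ENNReal.toReal_eq_one_iff _).mp h1
  · have hms : MeasurableSet {x : ℝ | (x : ℂ) ∉ spectrum ℂ a} :=
      ((spectrum.isClosed a).preimage Complex.continuous_ofReal).isOpen_compl.measurableSet
    rw [Measure.map_apply hm hms]
    convert measure_empty (μ := ν)
    ext z
    simp [hre]
  · intro g hg
    have he : ∀ z : X, g (((z : ℂ).re : ℝ) : ℂ) = g z := fun z => by rw [hre]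
    rw [cfc_apply g a hn hg, ← hψ, hνc]
    have hms : MeasurableEmbedding (fun z : X => (z : ℂ).re) := by
      refine Topology.IsClosedEmbedding.measurableEmbedding ?_
      refine Continuous.isClosedEmbedding (by fun_prop) fun z w h => ?_
      apply Subtype.ext
      rw [← hre z, ← hre w]
      exact congrArg _ h
    rw [hms.integral_map]
    simp only [he]
    rfl

/-- The law `μ_a` of a self-adjoint element `a` of a C⋆-probability space: the unique measure
satisfying `IsLaw` (see `isLaw_law` and `IsLaw.unique`). -/
def law (ha : IsSelfAdjoint a) : Measure ℝ := (exists_isLaw φ ha).choose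

theorem isLaw_law (ha : IsSelfAdjoint a) : IsLaw φ a (law φ ha) := (exists_isLaw φ ha).choose_spec

end Law

/-- The state `φ_n(A) = (1/n) ∑ i, φ(A(i,i))` on `Mat_n(A)`. -/
def CStarState.matrix {A : Type*} [CStarAlgebra A] [PartialOrder A] [StarOrderedRing A]
    (φ : CStarState A) (n : ℕ) [NeZero n] : CStarState (CStarMatrix (Fin n) (Fin n) A) where
  toFun :=
    { toFun := fun M => (n : ℂ)⁻¹ * ∑ i, φ (M i i)
      map_add' := fun M N => by
        simp [CStarMatrix.add_apply, Finset.sum_add_distrib, mul_add]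
      map_smul' := fun c M => by
        simp only [CStarMatrix.smul_apply, map_smul, smul_eq_mul, RingHom.id_apply,
          ← Finset.mul_sum]
        ring }
  nonneg M := by
    show 0 ≤ (n : ℂ)⁻¹ * ∑ i, φ ((star M * M) i i)
    refine mul_nonneg (by positivity) (Finset.sum_nonneg fun i _ => ?_)
    rw [CStarMatrix.mul_apply, map_sum]
    exact Finset.sum_nonneg fun j _ => φ.nonneg (M j i)
  map_one := by
    show (n : ℂ)⁻¹ * ∑ i : Fin n, φ ((1 : CStarMatrix (Fin n) (Fin n) A) i i) = 1
    simp [CStarMatrix.one_apply_eq, φ.map_one, NeZero.ne n]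

/-! ### Boltzmann–Fock space -/

namespace BoltzmannFock

/-- The Hilbert space with orthonormal basis indexed by finite sequences of positive integers. -/
abbrev H : Type := lp (fun _ : List ℕ+ => ℂ) 2

/-- The orthonormal basis vector `v(i_1 ⋯ i_k)`. -/
def v (w : List ℕ+) : H := lp.single 2 w 1

theorem orthonormal_v : Orthonormal ℂ v := by
  rw [orthonormal_iff_ite]
  intro w w'
  simp only [v]
  rw [lp.inner_single_left, lp.single_apply]
  by_cases h : w = w' <;> simp [h]

/-- The vacuum vector `1_H = v(∅)`. -/
def vacuum : H := v []

/-- The vacuum state `A ↦ (1_H, A 1_H)` on `B(H)`. -/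
def vacuumState : CStarState (H →L[ℂ] H) where
  toFun :=
    { toFun := fun T => ⟪vacuum, T vacuum⟫_ℂ
      map_add' := fun S T => by simp
      map_smul' := fun c T => by simp }
  nonneg T := by
    show 0 ≤ ⟪vacuum, (star T * T) vacuum⟫_ℂ
    rw [ContinuousLinearMap.star_eq_adjoint, mul_apply_eq_comp,
      ContinuousLinearMap.adjoint_inner_right]
    rw [inner_self_eq_norm_sq_to_K]
    exact pow_nonneg (RCLike.ofReal_nonneg.mpr (norm_nonneg _)) 2
  map_one := by
    show ⟪vacuum, vacuum⟫_ℂ = 1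
    rw [inner_self_eq_norm_sq_to_K, vacuum, orthonormal_v.1]
    simp

/-- The raising operator `Σ_i`, the isometry with `Σ_i v(w) = v(i w)` (see `raising_v`). -/
def raising (i : ℕ+) : H →L[ℂ] H :=
  ((orthonormal_v.comp (fun w => i :: w)
    List.cons_injective).orthogonalFamily.linearIsometry).toContinuousLinearMap

theorem raising_v (i : ℕ+) (w : List ℕ+) : raising i (v w) = v (i :: w) := by
  show (orthonormal_v.comp (fun w => i :: w)
    List.cons_injective).orthogonalFamily.linearIsometry (lp.single 2 w 1) = _
  rw [OrthogonalFamily.linearIsometry_apply_single]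
  simp

/-- The semicircular variables `Ξ_ℓ = i^ℓ Σ_ℓ + i^{-ℓ} Σ_ℓ^*`. -/
def Xi (l : ℕ+) : H →L[ℂ] H :=
  Complex.I ^ (l : ℕ) • raising l + Complex.I ^ (-(l : ℤ)) • star (raising l)

theorem isSelfAdjoint_Xi (l : ℕ+) : IsSelfAdjoint (Xi l) := by
  have h : star (Complex.I ^ (l : ℕ)) = Complex.I ^ (-(l : ℤ)) := by
    simp [star_pow, zpow_neg, ← inv_pow]
  have h' : star (Complex.I ^ (-(l : ℤ))) = Complex.I ^ (l : ℕ) := by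
    rw [← h, star_star]
  rw [IsSelfAdjoint, Xi, star_add, star_smul, star_smul, h, h', star_star, add_comm]

/-- The measure `μ_f`: the law of `f(Ξ)` in `(Mat_n(B(H)), φ_n)`, where `φ` is the vacuum state. -/
def mu {n : ℕ} [NeZero n] (f : Matrix (Fin n) (Fin n) NCPoly) (hf : IsSelfAdjoint f) :
    MeasureTheory.Measure ℝ :=
  law (vacuumState.matrix n) (NCPoly.isSelfAdjoint_evalMatrix Xi isSelfAdjoint_Xi hf)

end BoltzmannFock

end

/-!
Let `φ` be the vacuum state and `M` the bicommutant of `{Ξ_ℓ}`. Raising on the right gives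
operators `Ξʳ_m` commuting with every `Ξ_ℓ`, and the words `v(w)` are obtained recursively from the
vacuum by applying the `Ξʳ_m`. So the vacuum is cyclic for the commutant of `M`, hence separating
for `M`, that is, `φ` is faithful on `M`; therefore `φ_n` is faithful on `Mat_n(M)`, which contains
`g(f(Ξ))` for every `g`. Taking for `g` the distance to `supp μ_f`, the law annihilates `g²`, so
`g(f(Ξ)) = 0` by faithfulness, and `g` vanishes on the spectrum.
-/

open scoped ComplexOrder InnerProductSpace

namespace NCPoly

theorem eval_mem {A : Type*} [Ring A] [Algebra ℂ A] {a : ℕ+ → A} {S : Subalgebra ℂ A}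
    (ha : ∀ l, a l ∈ S) (p : NCPoly) : eval a p ∈ S := by
  let b : ℕ+ → S := fun l => ⟨a l, ha l⟩
  have h : eval a = S.val.comp (eval b) :=
    MonoidAlgebra.algHom_ext' (FreeMonoid.hom_eq fun l => by simp [eval, b])
      (Subsingleton.elim _ _)
  rw [h]
  exact (eval b p).2

end NCPoly

namespace CStarState

variable {A : Type*} [CStarAlgebra A]

/-- The state `φ` is faithful on the set `S`: no nonzero `b ∈ S` has `φ(b⋆ b) = 0`. -/
def IsFaithfulOn (φ : CStarState A) (S : Set A) : Prop :=
  ∀ b ∈ S, φ (star b * b) = 0 → b = 0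

theorem matrix_star_mul_self [PartialOrder A] [StarOrderedRing A] (φ : CStarState A) {n : ℕ}
    [NeZero n] (M : CStarMatrix (Fin n) (Fin n) A) :
    φ.matrix n (star M * M) = (n : ℂ)⁻¹ * ∑ j, ∑ i, φ (star (M i j) * M i j) := by
  refine congrArg ((n : ℂ)⁻¹ * ·) (Finset.sum_congr rfl fun j _ => ?_)
  rw [CStarMatrix.mul_apply, map_sum]
  rfl

theorem IsFaithfulOn.matrix [PartialOrder A] [StarOrderedRing A] {φ : CStarState A} {S : Set A}
    (hφ : φ.IsFaithfulOn S) (n : ℕ) [NeZero n] :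
    (φ.matrix n).IsFaithfulOn {M | ∀ i j, M i j ∈ S} := by
  intro M hM h
  rw [matrix_star_mul_self, mul_eq_zero_iff_left (inv_ne_zero (Nat.cast_ne_zero.mpr (NeZero.ne n))),
    Finset.sum_eq_zero_iff_of_nonneg fun j _ => Finset.sum_nonneg fun i _ => φ.nonneg (M i j)] at h
  ext i j
  have hj := (Finset.sum_eq_zero_iff_of_nonneg fun i _ => φ.nonneg (M i j)).mp
    (h j (Finset.mem_univ j))
  exact hφ _ (hM i j) (hj i (Finset.mem_univ i))

end CStarState

namespace IsLaw

open MeasureTheory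

variable {A : Type*} [CStarAlgebra A] {φ : CStarState A} {a : A} {μ : Measure ℝ}

theorem ofReal_image_support_subset (hμ : IsLaw φ a μ) :
    Complex.ofReal '' μ.support ⊆ spectrum ℂ a := by
  rw [Set.image_subset_iff]
  exact Measure.support_subset_of_isClosed
    ((spectrum.isClosed a).preimage Complex.continuous_ofReal) (mem_ae_iff.mpr hμ.carried)

theorem eqOn_spectrum_zero_of_ae_eq_zero [IsStarNormal a] {S : Set A} (hμ : IsLaw φ a μ)
    (hφ : φ.IsFaithfulOn S) {g : ℂ → ℂ} (hgS : cfc g a ∈ S) (hg : ContinuousOn g (spectrum ℂ a))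
    (hg0 : ∀ᵐ x : ℝ ∂μ, g x = 0) : Set.EqOn g 0 (spectrum ℂ a) := by
  have hnorm : star (cfc g a) * cfc g a = cfc (fun z => star (g z) * g z) a := by
    rw [← cfc_star, ← cfc_mul _ _ a hg.star hg]
  have hφg : φ (star (cfc g a) * cfc g a) = 0 := by
    rw [hnorm, hμ.integral_eq (fun z => star (g z) * g z) (hg.star.mul hg)]
    exact integral_eq_zero_of_ae (hg0.mono fun x hx => by simp [hx])
  have hcfc : cfc g a = cfc (0 : ℂ → ℂ) a := by rw [hφ _ hgS hφg, Pi.zero_def, cfc_const_zero]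
  exact eqOn_of_cfc_eq_cfc hcfc

theorem ofReal_image_support_eq_spectrum [IsStarNormal a] {S : Set A} (hμ : IsLaw φ a μ)
    (hφ : φ.IsFaithfulOn S) (hS : ∀ g : ℂ → ℂ, cfc g a ∈ S) :
    Complex.ofReal '' μ.support = spectrum ℂ a := by
  have := hμ.isProbabilityMeasure
  set K := Complex.ofReal '' μ.support
  have hK : IsClosed K :=
    Complex.isometry_ofReal.isClosedEmbedding.isClosedMap _ Measure.isClosed_support
  have hK₀ : K.Nonempty := (Measure.nonempty_support (IsProbabilityMeasure.ne_zero μ)).image _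
  let g : ℂ → ℂ := fun z => (Metric.infDist z K : ℝ)
  have hg : Continuous g := Complex.continuous_ofReal.comp (Metric.continuous_infDist_pt K)
  have hg0 : ∀ᵐ x : ℝ ∂μ, g x = 0 := by
    filter_upwards [Measure.support_mem_ae] with x hx
    exact Complex.ofReal_eq_zero.mpr (Metric.infDist_zero_of_mem (Set.mem_image_of_mem _ hx))
  refine hμ.ofReal_image_support_subset.antisymm fun z hz => ?_
  have hgz := hμ.eqOn_spectrum_zero_of_ae_eq_zero hφ (hS g) hg.continuousOn hg0 hz
  exact (hK.mem_iff_infDist_zero hK₀).mpr (Complex.ofReal_eq_zero.mp hgz)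

end IsLaw

theorem commute_ofMatrix_scalar_iff {n A : Type*} [Fintype n] [DecidableEq n] [Semiring A]
    {M : CStarMatrix n n A} {b : A} :
    Commute M (CStarMatrix.ofMatrix (Matrix.scalar n b)) ↔ ∀ i j, Commute (M i j) b := by
  have h := Matrix.scalar_commute_iff (r := b) (M := CStarMatrix.ofMatrix.symm M)
  refine (Commute.symm_iff.trans h).trans ?_
  rw [← Matrix.ext_iff]
  exact forall₂_congr fun i j => eq_comm

theorem cfc_apply_mem_centralizer {n A : Type*} [Fintype n] [DecidableEq n] [CStarAlgebra A]
    [PartialOrder A] [StarOrderedRing A] {M : CStarMatrix n n A} {T : Set A} (hM : IsSelfAdjoint M)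
    (hT : ∀ i j, M i j ∈ T.centralizer) (g : ℂ → ℂ) (i j : n) : cfc g M i j ∈ T.centralizer := by
  intro b hb
  have hMb : Commute M (CStarMatrix.ofMatrix (Matrix.scalar n b)) :=
    commute_ofMatrix_scalar_iff.mpr fun i j => (hT i j b hb).symm
  exact (commute_ofMatrix_scalar_iff.mp (hMb.cfc (by rwa [hM.star_eq]) g) i j).symm

theorem eq_zero_of_mem_centralizer_of_apply_eq_zero {R E : Type*} [Semiring R] [AddCommMonoid E]
    [Module R E] [TopologicalSpace E] [T2Space E] {s : Set (E →L[R] E)} {x : E}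
    (hx : Dense (Submodule.span R ((· x) '' s) : Set E)) {T : E →L[R] E} (hT : T ∈ s.centralizer)
    (hTx : T x = 0) : T = 0 := by
  refine ContinuousLinearMap.ext_on hx ?_
  rintro _ ⟨S, hS, rfl⟩
  calc T (S x) = S (T x) := congrArg (· x) (hT S hS).symm
    _ = 0 := by rw [hTx, map_zero]

namespace BoltzmannFock

theorem inner_v (w u : List ℕ+) : ⟪v w, v u⟫_ℂ = if w = u then 1 else 0 :=
  orthonormal_iff_ite.mp orthonormal_v w u

theorem ext_inner_v {x y : H} (h : ∀ w, ⟪v w, x⟫_ℂ = ⟪v w, y⟫_ℂ) : x = y := by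
  ext w
  simpa [v, lp.inner_single_left] using h w

theorem dense_span_range_v : Dense (Submodule.span ℂ (Set.range v) : Set H) := by
  rw [Submodule.dense_iff_topologicalClosure_eq_top, Submodule.topologicalClosure_eq_top_iff,
    Submodule.eq_bot_iff]
  refine fun x hx => ext_inner_v fun w => ?_
  rw [inner_zero_right]
  exact hx _ (Submodule.subset_span ⟨w, rfl⟩)

theorem operator_ext {S T : H →L[ℂ] H} (h : ∀ w, S (v w) = T (v w)) : S = T :=
  ContinuousLinearMap.ext_on dense_span_range_v (Set.forall_mem_range.mpr h)

section WordIsometry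

variable {g : List ℕ+ → List ℕ+} (hg : g.Injective)

/-- The isometry of `H` induced by an injective map `g` of words, `v(w) ↦ v(g w)`. The raising
operator `Σ_i` is the case `g w = i w`. -/
noncomputable def wordIsometry : H →L[ℂ] H :=
  (orthonormal_v.comp g hg).orthogonalFamily.linearIsometry.toContinuousLinearMap

theorem wordIsometry_v (w : List ℕ+) : wordIsometry hg (v w) = v (g w) := by
  refine ((orthonormal_v.comp g hg).orthogonalFamily.linearIsometry_apply_single 1).trans ?_
  simp

theorem inner_v_star_wordIsometry_v (w u : List ℕ+) :
    ⟪v w, star (wordIsometry hg) (v u)⟫_ℂ = if g w = u then 1 else 0 := by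
  rw [ContinuousLinearMap.star_eq_adjoint, ContinuousLinearMap.adjoint_inner_right,
    wordIsometry_v, inner_v]

theorem star_wordIsometry_v_apply (w : List ℕ+) : star (wordIsometry hg) (v (g w)) = v w :=
  ext_inner_v fun u => by simp only [inner_v_star_wordIsometry_v, inner_v, hg.eq_iff]

theorem star_wordIsometry_v_of_notMem_range {u : List ℕ+} (hu : u ∉ Set.range g) :
    star (wordIsometry hg) (v u) = 0 :=
  ext_inner_v fun w => by
    rw [inner_v_star_wordIsometry_v, if_neg fun h => hu ⟨w, h⟩, inner_zero_right]

end WordIsometry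

theorem star_raising_v_nil (i : ℕ+) : star (raising i) (v []) = 0 :=
  star_wordIsometry_v_of_notMem_range List.cons_injective (by simp)

theorem star_raising_v_cons (i j : ℕ+) (w : List ℕ+) :
    star (raising i) (v (j :: w)) = if i = j then v w else 0 := by
  split_ifs with h
  · exact h ▸ star_wordIsometry_v_apply List.cons_injective w
  · exact star_wordIsometry_v_of_notMem_range List.cons_injective (by simp [h])

/-- The right raising operator, the isometry with `v(w) ↦ v(w i)`. -/
noncomputable def rightRaising (i : ℕ+) : H →L[ℂ] H :=
  wordIsometry (List.append_left_injective [i])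

theorem rightRaising_v (i : ℕ+) (w : List ℕ+) : rightRaising i (v w) = v (w ++ [i]) :=
  wordIsometry_v _ w

theorem star_rightRaising_v_nil (i : ℕ+) : star (rightRaising i) (v []) = 0 :=
  star_wordIsometry_v_of_notMem_range _ (by simp)

theorem star_rightRaising_v_append (i j : ℕ+) (w : List ℕ+) :
    star (rightRaising i) (v (w ++ [j])) = if i = j then v w else 0 := by
  split_ifs with h
  · exact h ▸ star_wordIsometry_v_apply (List.append_left_injective [i]) w
  · exact star_wordIsometry_v_of_notMem_range _ (by simp [h])

/-- The orthogonal projection onto the line spanned by the vacuum. -/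
noncomputable def vacuumProjection : H →L[ℂ] H := InnerProductSpace.rankOne ℂ vacuum vacuum

theorem isSelfAdjoint_vacuumProjection : IsSelfAdjoint vacuumProjection :=
  InnerProductSpace.adjoint_rankOne vacuum vacuum

theorem vacuumProjection_v (w : List ℕ+) :
    vacuumProjection (v w) = if w = [] then vacuum else 0 := by
  rw [vacuumProjection, InnerProductSpace.rankOne_apply, vacuum, inner_v, ite_smul, one_smul,
    zero_smul]
  exact if_congr eq_comm rfl rfl

theorem commute_raising_rightRaising (l m : ℕ+) : Commute (raising l) (rightRaising m) :=
  operator_ext fun w => by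
    simp only [mul_apply_eq_comp, raising_v, rightRaising_v, List.cons_append]

theorem star_raising_mul_rightRaising (l m : ℕ+) :
    star (raising l) * rightRaising m =
      rightRaising m * star (raising l) + if l = m then vacuumProjection else 0 := by
  refine operator_ext fun w => ?_
  rcases w with _ | ⟨j, w⟩
  · by_cases h : l = m <;>
      simp [rightRaising_v, star_raising_v_nil, star_raising_v_cons, vacuumProjection_v, h, vacuum]
  · have hP : (if l = m then vacuumProjection else 0) (v (j :: w)) = 0 := by
      split_ifs <;> simp [vacuumProjection_v]
    rw [add_apply, hP, add_zero, mul_apply_eq_comp, mul_apply_eq_comp, rightRaising_v,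
      List.cons_append, star_raising_v_cons, star_raising_v_cons]
    split_ifs
    · rw [rightRaising_v]
    · rw [map_zero]

theorem star_rightRaising_mul_raising (l m : ℕ+) :
    star (rightRaising m) * raising l =
      raising l * star (rightRaising m) + if l = m then vacuumProjection else 0 := by
  have h := congrArg star (star_raising_mul_rightRaising l m)
  rwa [star_mul, star_star, star_add, star_mul, star_star, apply_ite star,
    isSelfAdjoint_vacuumProjection.star_eq, star_zero] at h

/-- The right-handed counterparts `Ξʳ_ℓ` of the `Ξ_ℓ`, which commute with them. -/
noncomputable def rightXi (l : ℕ+) : H →L[ℂ] H :=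
  Complex.I ^ (l : ℕ) • rightRaising l + Complex.I ^ (-(l : ℤ)) • star (rightRaising l)

theorem commute_Xi_rightXi (l m : ℕ+) : Commute (Xi l) (rightXi m) := by
  have hLR := (commute_raising_rightRaising l m).eq
  have hLR' : star (raising l) * star (rightRaising m) =
      star (rightRaising m) * star (raising l) := (commute_raising_rightRaising l m).star_star.eq
  simp only [Commute, SemiconjBy, Xi, rightXi, add_mul, mul_add, smul_mul_smul_comm, hLR, hLR',
    star_raising_mul_rightRaising, star_rightRaising_mul_raising]
  rcases eq_or_ne l m with rfl | h
  · -- The vacuum projection occurs in both products with coefficient `i^l i^{-l}`.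
    simp only [if_true]
    module
  · simp only [if_neg h]
    module

/-- The vectors `S 1_H` for `S` in the commutant of the `Ξ_ℓ`. -/
noncomputable def commutantOrbit : Submodule ℂ H :=
  (Subalgebra.centralizer ℂ (Set.range Xi)).toSubmodule.map
    (ContinuousLinearMap.apply ℂ H vacuum).toLinearMap

theorem vacuum_mem_commutantOrbit : vacuum ∈ commutantOrbit :=
  ⟨1, one_mem (Subalgebra.centralizer ℂ _), rfl⟩

theorem rightXi_mem_commutantOrbit (m : ℕ+) {x : H} (hx : x ∈ commutantOrbit) :
    rightXi m x ∈ commutantOrbit := by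
  obtain ⟨S, hS, rfl⟩ := hx
  have hm : rightXi m ∈ Subalgebra.centralizer ℂ (Set.range Xi) :=
    Set.forall_mem_range.mpr fun l => commute_Xi_rightXi l m
  exact ⟨rightXi m * S, Subalgebra.mul_mem _ hm hS, rfl⟩

theorem v_append_singleton (w : List ℕ+) (m : ℕ+) :
    v (w ++ [m]) = (Complex.I ^ (m : ℕ))⁻¹ •
      (rightXi m (v w) - Complex.I ^ (-(m : ℤ)) • star (rightRaising m) (v w)) := by
  rw [eq_inv_smul_iff₀ (pow_ne_zero _ Complex.I_ne_zero), ← rightRaising_v, eq_sub_iff_add_eq]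
  rfl

theorem v_mem_commutantOrbit (w : List ℕ+) : v w ∈ commutantOrbit := by
  suffices h : v w ∈ commutantOrbit ∧ ∀ m, star (rightRaising m) (v w) ∈ commutantOrbit from h.1
  induction w using List.reverseRecOn with
  | nil =>
    refine ⟨vacuum_mem_commutantOrbit, fun m => ?_⟩
    rw [star_rightRaising_v_nil]
    exact zero_mem _
  | append_singleton w k ih =>
    constructor
    · rw [v_append_singleton]
      exact Submodule.smul_mem _ _ (Submodule.sub_mem _ (rightXi_mem_commutantOrbit k ih.1)
        (Submodule.smul_mem _ _ (ih.2 k)))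
    · intro m
      rw [star_rightRaising_v_append]
      split_ifs
      exacts [ih.1, zero_mem _]

theorem dense_span_centralizer_Xi_apply_vacuum :
    Dense (Submodule.span ℂ ((· vacuum) '' (Set.range Xi).centralizer) : Set H) :=
  dense_span_range_v.mono <| Submodule.span_mono <|
    Set.range_subset_iff.mpr v_mem_commutantOrbit

theorem vacuumState_star_mul_self (T : H →L[ℂ] H) :
    vacuumState (star T * T) = (‖T vacuum‖ : ℂ) ^ 2 := by
  refine (ContinuousLinearMap.adjoint_inner_right T vacuum (T vacuum)).trans ?_
  exact inner_self_eq_norm_sq_to_K _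

theorem vacuumState_isFaithfulOn_bicommutant :
    vacuumState.IsFaithfulOn (Set.range Xi).centralizer.centralizer := by
  intro T hT h
  rw [vacuumState_star_mul_self, sq_eq_zero_iff, Complex.ofReal_eq_zero, norm_eq_zero] at h
  exact eq_zero_of_mem_centralizer_of_apply_eq_zero dense_span_centralizer_Xi_apply_vacuum hT h

theorem eval_Xi_mem_bicommutant (p : NCPoly) :
    NCPoly.eval Xi p ∈ (Set.range Xi).centralizer.centralizer :=
  NCPoly.eval_mem (S := Subalgebra.centralizer ℂ (Set.range Xi).centralizer)
    (fun l => Set.subset_centralizer_centralizer ⟨l, rfl⟩) p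

end BoltzmannFock

/-- For every `n ≥ 1` and every self-adjoint `f ∈ Mat_n(ℂ⟨X⟩)`, `supp μ_f = Spec(f(Ξ))` as subsets
of the complex plane. -/
theorem proposition3p13 (n : ℕ) [NeZero n] (f : Matrix (Fin n) (Fin n) NCPoly)
    (hf : IsSelfAdjoint f) :
    Complex.ofReal '' (BoltzmannFock.mu f hf).support =
      spectrum ℂ (NCPoly.evalMatrix BoltzmannFock.Xi f) := by
  have hfa := NCPoly.isSelfAdjoint_evalMatrix BoltzmannFock.Xi BoltzmannFock.isSelfAdjoint_Xi hf
  have := hfa.isStarNormal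
  have hlaw := isLaw_law (BoltzmannFock.vacuumState.matrix n) hfa
  exact hlaw.ofReal_image_support_eq_spectrum
    (BoltzmannFock.vacuumState_isFaithfulOn_bicommutant.matrix n) fun g =>
      cfc_apply_mem_centralizer hfa (fun i j => BoltzmannFock.eval_Xi_mem_bicommutant (f i j)) g
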